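/- Consider the affine system $\dot x=f(x)+g(x)u$, $y=h(x)$ with $x\in\mathbb R^n$, $u,y\in\mathbb R^p$, where $f$, $h$ and the columns $g^1,\dots,g^p$ of $g$ are of class $C^\infty$, $f$ is globally Lipschitz, $f(0)=0$ and $h(0)=0$. Write $L_F\varphi=\frac{\partial\varphi}{\partial x}F$ for Lie derivatives, $[F,G]=\frac{\partial G}{\partial x}F-\frac{\partial F}{\partial x}G$ and $ad_F^0G=G$, $ad_F^kG=[F,ad_F^{k-1}G]$. Suppose: (H1) the system has uniform relative degree $\{r_1,\dots,r_p\}$ with $1\le r_i\le 2$, i.e. $L_{g^j}L_f^kh_i(x)=0$ for all $x\in\mathbb R^n$, all $i,j$ and all $0\le k<r_i-1$, and the $p\times p$ matrix $A(x)=\big(L_{g^j}L_f^{r_i-1}h_i(x)\big)_{i,j}$ is nonsingular for every $x\in\mathbb R^n$; (H2) with $b(x)=(L_f^{r_1}h_1(x),\dots,L_f^{r_p}h_p(x))^T$, $\tilde f=f-gA^{-1}b$ and $\tilde g=gA^{-1}$ (with columns $\tilde g_i$), the vector fields $X_i^k=ad_{\tilde f}^{k-1}\tilde g_i$, $1\le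 i\le p$, $1\le k\le r_i$, are complete; (H3) $[X_i^1,X_j^1]=0$ for all $1\le i,j\le p$. Let $\xi_1$ be the vector of the $h_i(x)$ with $r_i=1$, $\xi_2$ the vector of the $h_i(x)$ with $r_i=2$, and $\xi_3$ the vector of the $L_fh_i(x)$ with $r_i=2$. Let $V_1(\xi_1)$ and $V_2(\xi_2)$ be any functions of class $C^1$ that are positive semidefinite (nonnegative and zero at the origin), and let $\lambda\ge 0$. Apply the state feedback with new input $v\in\mathbb R^p$ $$u=A(x)^{-1}\big(v-b(x)-c(x)\big),$$ where the entries of $c(x)\in\mathbb R^p$ with $r_i=1$ form the vector $\left(\frac{\partial V_1(\xi_1)}{\partial\xi_1}\right)^T$ and those with $r_i=2$ form the vector $\left(\frac{\partial V_2(\xi_2)}{\partial\xi_2}\right)^T+\lambda\xi_3$. Then the resulting system with input $v$ and output $y$ is globally nonlinear negative imaginary (NI), with the positive semidefinite storage function of class $C^1$ $$V=V_1(\xi_1)+V_2(\xi_2)+\tfrac12\xi_3^T\xi_3,$$ that is, $\dot V\le v^T\dot y$ along all of its trajectories, at all times $t\ge 0$ of their existence. If moreover $\lambda>0$, then the resulting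 system is nonlinear output strictly negative imaginary (OSNI) with the same storage function $V$ and degree of output strictness $\epsilon=\min\{1,\lambda\}>0$, that is, $\dot V\le v^T\dot y-\epsilon\|\dot y\|^2$ along all of its trajectories. -/

import Mathlib

open scoped ContDiff Matrix InnerProductSpace

noncomputable section

namespace NegImag

/-- `ℝⁿ` with the Euclidean norm. -/
abbrev Vec (n : ℕ) : Type := EuclideanSpace ℝ (Fin n)

/-! ### Systems, trajectories, and the negative imaginary property -/

/-- A state-space system `ẋ = F(x, u)`, `y = h(x)` with state in `ℝⁿ` and input and output
in `ℝᵖ`. -/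
structure ControlSystem (n p : ℕ) where
  /-- the right-hand side `F(x, u)` of the state equation -/
  rhs : Vec n → Vec p → Vec n
  /-- the output map `h` -/
  out : Vec n → Vec p

/-- The time interval `[0, T)`, where `T ≤ ∞`. -/
def timeInterval (T : EReal) : Set ℝ := {t | 0 ≤ t ∧ (t : EReal) < T}

/-- `x` is a solution of `ẋ(t) = F(x(t), u(t))` on `[0, T)` for the input `u`
(the derivative at `t = 0` is the right derivative). -/
def ControlSystem.IsTrajectory {n p : ℕ} (S : ControlSystem n p) (T : EReal)
    (u : ℝ → Vec p) (x : ℝ → Vec n) : Prop :=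
  ∀ t ∈ timeInterval T, HasDerivWithinAt x (S.rhs (x t) (u t)) (timeInterval T) t

/-- Positive semidefinite functions: `V(0) = 0` and `V ≥ 0`. -/
def IsPosSemidefFun {E : Type*} [Zero E] (V : E → ℝ) : Prop :=
  V 0 = 0 ∧ ∀ x, 0 ≤ V x

/-- `V` is a positive semidefinite function of class `C¹` such that, along all trajectories,
`d/dt V(x(t)) ≤ u(t)ᵀ ẏ(t) - ε ‖ẏ(t)‖²` at all times at which the trajectory is defined. The
derivative `ẏ(t)` that occurs here is required to exist. -/
def ControlSystem.IsStorage {n p : ℕ} (S : ControlSystem n p) (ε : ℝ) (V : Vec n → ℝ) : Prop :=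
  ContDiff ℝ 1 V ∧ IsPosSemidefFun V ∧
    ∀ (T : EReal) (u : ℝ → Vec p) (x : ℝ → Vec n), S.IsTrajectory T u x →
      ∀ t ∈ timeInterval T,
        DifferentiableWithinAt ℝ (fun s => S.out (x s)) (timeInterval T) t ∧
        derivWithin (fun s => V (x s)) (timeInterval T) t ≤
          ⟪u t, derivWithin (fun s => S.out (x s)) (timeInterval T) t⟫_ℝ
            - ε * ‖derivWithin (fun s => S.out (x s)) (timeInterval T) t‖ ^ 2

/-- `V` is a storage function showing that the system is nonlinear NI:
`d/dt V(x(t)) ≤ u(t)ᵀ ẏ(t)`. -/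
def ControlSystem.IsNIStorage {n p : ℕ} (S : ControlSystem n p) (V : Vec n → ℝ) : Prop :=
  S.IsStorage 0 V

/-- Nonlinear negative imaginary systems. -/
def ControlSystem.IsNI {n p : ℕ} (S : ControlSystem n p) : Prop :=
  ∃ V : Vec n → ℝ, S.IsNIStorage V

/-- `V` is a storage function showing that the system is nonlinear OSNI with degree of output
strictness `ε > 0`: `d/dt V(x(t)) ≤ u(t)ᵀ ẏ(t) - ε ‖ẏ(t)‖²`. -/
def ControlSystem.IsOSNIStorage {n p : ℕ} (S : ControlSystem n p) (ε : ℝ) (V : Vec n → ℝ) :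
    Prop :=
  0 < ε ∧ S.IsStorage ε V

/-- Nonlinear output strictly negative imaginary systems. -/
def ControlSystem.IsOSNI {n p : ℕ} (S : ControlSystem n p) : Prop :=
  ∃ (V : Vec n → ℝ) (ε : ℝ), S.IsOSNIStorage ε V

/-! ### Input-affine systems and state feedback -/

/-- The data of an affine system `ẋ = f(x) + g(x) u`, `y = h(x)`; the matrix `g(x)` is given by
its columns `g¹(x), …, gᵖ(x)`. -/
structure AffineSystem (n p : ℕ) where
  /-- the drift vector field -/
  f : Vec n → Vec n
  /-- the columns of the input matrix -/
  g : Fin p → Vec n → Vec n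
  /-- the output map -/
  h : Vec n → Vec p

/-- The standing assumptions on affine systems: `f`, `h` and the columns of `g` are of class
`C^∞`, `f` is globally Lipschitz, `f(0) = 0` and `h(0) = 0`. -/
structure AffineSystem.IsAdmissible {n p : ℕ} (S : AffineSystem n p) : Prop where
  contDiff_f : ContDiff ℝ ∞ S.f
  contDiff_g : ∀ j, ContDiff ℝ ∞ (S.g j)
  contDiff_h : ContDiff ℝ ∞ S.h
  lipschitz_f : ∃ K : NNReal, LipschitzWith K S.f
  f_zero : S.f 0 = 0
  h_zero : S.h 0 = 0

/-- The system with new input `v` that results from the state feedback `u = k(x, v)`. -/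
def AffineSystem.closedLoop {n p : ℕ} (S : AffineSystem n p) (k : Vec n → Vec p → Vec p) :
    ControlSystem n p where
  rhs x v := S.f x + ∑ j, k x v j • S.g j x
  out := S.h

/-! ### Lie derivatives and relative degree -/

/-- The Lie derivative `L_F φ (x) = (∂φ/∂x)(x) F(x)` of a scalar function. -/
def lieDeriv {n : ℕ} (F : Vec n → Vec n) (φ : Vec n → ℝ) (x : Vec n) : ℝ :=
  fderiv ℝ φ x (F x)

/-- `L_f^k h_i`. -/
def AffineSystem.lieOut {n p : ℕ} (S : AffineSystem n p) (k : ℕ) (i : Fin p) : Vec n → ℝ :=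
  (lieDeriv S.f)^[k] (fun x => S.h x i)

/-- The `p × p` matrix `A(x)` with `(i, j)` entry `L_{g^j} L_f^{r_i - 1} h_i(x)`. -/
def AffineSystem.decoupling {n p : ℕ} (S : AffineSystem n p) (r : Fin p → ℕ) (x : Vec n) :
    Matrix (Fin p) (Fin p) ℝ :=
  Matrix.of fun i j => lieDeriv (S.g j) (S.lieOut (r i - 1) i) x

/-- The vector with entries `L_f^{r_i} h_i(x)`. -/
def AffineSystem.driftTerm {n p : ℕ} (S : AffineSystem n p) (r : Fin p → ℕ) (x : Vec n) :
    Fin p → ℝ :=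
  fun i => S.lieOut (r i) i x

/-- Vector relative degree `{r_1, …, r_p}` at the point `x₀`. -/
def AffineSystem.HasVectorRelativeDegree {n p : ℕ} (S : AffineSystem n p) (r : Fin p → ℕ)
    (x₀ : Vec n) : Prop :=
  (∀ i, 1 ≤ r i) ∧
  (∀ᶠ x in nhds x₀, ∀ i, ∀ k, k + 1 < r i → ∀ j, lieDeriv (S.g j) (S.lieOut k i) x = 0) ∧
  (S.decoupling r x₀).det ≠ 0

/-- Uniform relative degree `{r_1, …, r_p}`. -/
def AffineSystem.HasUniformRelativeDegree {n p : ℕ} (S : AffineSystem n p) (r : Fin p → ℕ) :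
    Prop :=
  ∀ x, S.HasVectorRelativeDegree r x

/-- H1: uniform relative degree `{r_1, …, r_p}` with `1 ≤ r_i ≤ 2`. -/
def AffineSystem.H1 {n p : ℕ} (S : AffineSystem n p) (r : Fin p → ℕ) : Prop :=
  S.HasUniformRelativeDegree r ∧ ∀ i, 1 ≤ r i ∧ r i ≤ 2

/-! ### The vector fields `X_i^k` -/

/-- `f̃ = f - g A⁻¹ (L_f^{r_1} h_1, …, L_f^{r_p} h_p)ᵀ`. -/
def AffineSystem.fTilde {n p : ℕ} (S : AffineSystem n p) (r : Fin p → ℕ) (x : Vec n) : Vec n :=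
  S.f x - ∑ j, ((S.decoupling r x)⁻¹ *ᵥ S.driftTerm r x) j • S.g j x

/-- The `i`-th column of `g̃ = g A⁻¹`. -/
def AffineSystem.gTilde {n p : ℕ} (S : AffineSystem n p) (r : Fin p → ℕ) (i : Fin p)
    (x : Vec n) : Vec n :=
  ∑ j, (S.decoupling r x)⁻¹ j i • S.g j x

/-- `ad_F^k G`, where `ad_F G = [F, G] = (∂G/∂x) F - (∂F/∂x) G`. -/
def adIter {n : ℕ} (F : Vec n → Vec n) (k : ℕ) (G : Vec n → Vec n) : Vec n → Vec n :=
  (VectorField.lieBracket ℝ F)^[k] G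

/-- `X_i^k = ad_{f̃}^{k-1} g̃_i`. -/
def AffineSystem.X {n p : ℕ} (S : AffineSystem n p) (r : Fin p → ℕ) (i : Fin p) (k : ℕ) :
    Vec n → Vec n :=
  adIter (S.fTilde r) (k - 1) (S.gTilde r i)

/-- A vector field is complete if through every point there passes an integral curve that is
defined for all times. -/
def IsCompleteField {n : ℕ} (X : Vec n → Vec n) : Prop :=
  ∀ x₀ : Vec n, ∃ γ : ℝ → Vec n, γ 0 = x₀ ∧ ∀ t, HasDerivAt γ (X (γ t)) t

/-- H2: the vector fields `X_i^k`, `1 ≤ k ≤ r_i`, are complete. -/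
def AffineSystem.H2 {n p : ℕ} (S : AffineSystem n p) (r : Fin p → ℕ) : Prop :=
  ∀ i, ∀ k, 1 ≤ k → k ≤ r i → IsCompleteField (S.X r i k)

/-- H3: `[X_i^1, X_j^1] = 0`. -/
def AffineSystem.H3 {n p : ℕ} (S : AffineSystem n p) (r : Fin p → ℕ) : Prop :=
  ∀ i j, ∀ x, VectorField.lieBracket ℝ (S.X r i 1) (S.X r j 1) x = 0

/-! ### The state feedback and the storage function -/

/-- `ξ₁`: the outputs with `r_i = 1`. -/
def AffineSystem.xi1 {n p : ℕ} (S : AffineSystem n p) (r : Fin p → ℕ) (x : Vec n) :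
    EuclideanSpace ℝ {i : Fin p // r i = 1} :=
  WithLp.toLp 2 fun i => S.h x i

/-- `ξ₂`: the outputs with `r_i = 2`. -/
def AffineSystem.xi2 {n p : ℕ} (S : AffineSystem n p) (r : Fin p → ℕ) (x : Vec n) :
    EuclideanSpace ℝ {i : Fin p // r i = 2} :=
  WithLp.toLp 2 fun i => S.h x i

/-- `ξ₃ = ξ̇₂`: the functions `L_f h_i` for the outputs with `r_i = 2`. -/
def AffineSystem.xi3 {n p : ℕ} (S : AffineSystem n p) (r : Fin p → ℕ) (x : Vec n) :
    EuclideanSpace ℝ {i : Fin p // r i = 2} :=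
  WithLp.toLp 2 fun i => S.lieOut 1 i x

/-- The vector whose entries with `r_i = 1` are those of `(∂V₁/∂ξ₁)ᵀ` and whose entries with
`r_i = 2` are those of `(∂V₂/∂ξ₂)ᵀ + λ ξ₃`. -/
def AffineSystem.shapingTerm {n p : ℕ} (S : AffineSystem n p) (r : Fin p → ℕ)
    (V₁ : EuclideanSpace ℝ {i : Fin p // r i = 1} → ℝ)
    (V₂ : EuclideanSpace ℝ {i : Fin p // r i = 2} → ℝ) (lam : ℝ) (x : Vec n) : Fin p → ℝ :=
  fun i =>
    if h₁ : r i = 1 then gradient V₁ (S.xi1 r x) ⟨i, h₁⟩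
    else if h₂ : r i = 2 then
      gradient V₂ (S.xi2 r x) ⟨i, h₂⟩ + lam * S.xi3 r x ⟨i, h₂⟩
    else 0

/-- The state feedback
`u = A(x)⁻¹ (v - (L_f^{r_i} h_i(x))_i - ((∂V₁/∂ξ₁)ᵀ, (∂V₂/∂ξ₂)ᵀ + λ ξ₃))`. -/
def AffineSystem.niFeedback {n p : ℕ} (S : AffineSystem n p) (r : Fin p → ℕ)
    (V₁ : EuclideanSpace ℝ {i : Fin p // r i = 1} → ℝ)
    (V₂ : EuclideanSpace ℝ {i : Fin p // r i = 2} → ℝ) (lam : ℝ) (x : Vec n) (v : Vec p) :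
    Vec p :=
  WithLp.toLp 2
    ((S.decoupling r x)⁻¹ *ᵥ (v.ofLp - S.driftTerm r x - S.shapingTerm r V₁ V₂ lam x))

/-- The storage function `V₁(ξ₁) + V₂(ξ₂) + ½ ξ₃ᵀ ξ₃`, as a function of the state `x`. -/
def AffineSystem.niStorage {n p : ℕ} (S : AffineSystem n p) (r : Fin p → ℕ)
    (V₁ : EuclideanSpace ℝ {i : Fin p // r i = 1} → ℝ)
    (V₂ : EuclideanSpace ℝ {i : Fin p // r i = 2} → ℝ) (x : Vec n) : ℝ :=
  V₁ (S.xi1 r x) + V₂ (S.xi2 r x) + 1 / 2 * ⟪S.xi3 r x, S.xi3 r x⟫_ℝ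

end NegImag

end

namespace NegImag

open scoped ContDiff Matrix InnerProductSpace

/-! Multiplying the feedback by `A(x)` cancels `A⁻¹` and the drift terms, so the closed loop
decouples in output coordinates: `ẏ_i = v_i - ∂_i V₁` if `r_i = 1`, while `ẏ_i = (ξ₃)_i` and
`(ξ̇₃)_i = v_i - ∂_i V₂ - λ ẏ_i` if `r_i = 2` (`H1.fderiv_lieOut_niFeedback` and its
specializations). Substituting into the chain rule for `V`, the `∂_i V₂` terms cancel and `V̇ = vᵀẏ
- ∑_{r_i = 1} ẏ_i² - λ ∑_{r_i = 2} ẏ_i²`. Hence `V̇ ≤ vᵀẏ - ε‖ẏ‖²` whenever `ε ≤ 1` and `ε ≤ λ`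
(`isStorage_niStorage`); `ε = 0` gives NI and `ε = min 1 λ` gives OSNI. -/

/-- Each `t` lies in a nondegenerate `[0, q]` inside the interval. This makes `derivWithin` equal to
any derivative computed by the chain rule, even at `t = 0`. -/
lemma uniqueDiffOn_timeInterval (T : EReal) : UniqueDiffOn ℝ (timeInterval T) := by
  intro t ht
  obtain ⟨q, hq, hqT⟩ := EReal.lt_iff_exists_real_btwn.1 ht.2
  have htq : t < q := EReal.coe_lt_coe_iff.1 hq
  refine (uniqueDiffOn_Icc (ht.1.trans_lt htq) t ⟨ht.1, htq.le⟩).mono fun s hs => ⟨hs.1, ?_⟩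
  exact (EReal.coe_le_coe_iff.2 hs.2).trans_lt hqT

lemma hasDerivWithinAt_euclidean {ι : Type*} [Fintype ι] {z : ℝ → EuclideanSpace ℝ ι}
    {z' : EuclideanSpace ℝ ι} {s : Set ℝ} {t : ℝ}
    (hz : ∀ i, HasDerivWithinAt (fun τ => z τ i) (z' i) s t) : HasDerivWithinAt z z' s t :=
  hasFDerivWithinAt_euclidean.2 fun i => (hz i).hasFDerivWithinAt.congr_fderiv (by ext; simp)

lemma sum_eq_sum_one_add_sum_two {p : ℕ} {r : Fin p → ℕ} (hr : ∀ i, 1 ≤ r i ∧ r i ≤ 2)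
    (F : Fin p → ℝ) :
    ∑ i, F i = ∑ i : {i : Fin p // r i = 1}, F i + ∑ i : {i : Fin p // r i = 2}, F i := by
  rw [← Finset.sum_subtype (Finset.univ.filter fun i => r i = 1) (by simp) F,
    ← Finset.sum_subtype (Finset.univ.filter fun i => r i = 2) (by simp) F,
    ← Finset.sum_filter_add_sum_filter_not Finset.univ (fun i => r i = 1)]
  congr 2
  ext i
  have := hr i
  simp only [Finset.mem_filter, Finset.mem_univ, true_and]
  omega

namespace AffineSystem

variable {n p : ℕ} {S : AffineSystem n p} {r : Fin p → ℕ}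

lemma IsAdmissible.contDiff_lieOut_zero (hS : S.IsAdmissible) (i : Fin p) :
    ContDiff ℝ ∞ (S.lieOut 0 i) :=
  contDiff_euclidean.1 hS.contDiff_h i

lemma IsAdmissible.contDiff_lieOut_one (hS : S.IsAdmissible) (i : Fin p) :
    ContDiff ℝ ∞ (S.lieOut 1 i) :=
  ((hS.contDiff_lieOut_zero i).fderiv_right (m := ∞) le_rfl).clm_apply hS.contDiff_f

lemma IsAdmissible.contDiff_xi1 (hS : S.IsAdmissible) : ContDiff ℝ ∞ (S.xi1 r) :=
  contDiff_euclidean.2 fun i => hS.contDiff_lieOut_zero i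

lemma IsAdmissible.contDiff_xi2 (hS : S.IsAdmissible) : ContDiff ℝ ∞ (S.xi2 r) :=
  contDiff_euclidean.2 fun i => hS.contDiff_lieOut_zero i

lemma IsAdmissible.contDiff_xi3 (hS : S.IsAdmissible) : ContDiff ℝ ∞ (S.xi3 r) :=
  contDiff_euclidean.2 fun i => hS.contDiff_lieOut_one i

lemma IsAdmissible.xi1_zero (hS : S.IsAdmissible) : S.xi1 r 0 = 0 := by
  ext i; simp [xi1, hS.h_zero]

lemma IsAdmissible.xi2_zero (hS : S.IsAdmissible) : S.xi2 r 0 = 0 := by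
  ext i; simp [xi2, hS.h_zero]

lemma IsAdmissible.xi3_zero (hS : S.IsAdmissible) : S.xi3 r 0 = 0 := by
  ext i; simp [xi3, lieOut, lieDeriv, hS.f_zero]

lemma H1.isUnit_det (h1 : S.H1 r) (x : Vec n) : IsUnit (S.decoupling r x).det :=
  (h1.1 x).2.2.isUnit

lemma H1.lieDeriv_lieOut_zero (h1 : S.H1 r) {i : Fin p} (hi : r i = 2) (j : Fin p) (x : Vec n) :
    lieDeriv (S.g j) (S.lieOut 0 i) x = 0 :=
  (h1.1 x).2.1.self_of_nhds i 0 (by omega) j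

lemma fderiv_closedLoop (k : Vec n → Vec p → Vec p) (φ : Vec n → ℝ) (x : Vec n) (v : Vec p) :
    fderiv ℝ φ x ((S.closedLoop k).rhs x v)
      = lieDeriv S.f φ x + ∑ j, k x v j * lieDeriv (S.g j) φ x := by
  simp [closedLoop, lieDeriv, map_sum]

/-! ### Closed-loop output dynamics and dissipation -/

section Feedback

variable (V₁ : EuclideanSpace ℝ {i : Fin p // r i = 1} → ℝ)
  (V₂ : EuclideanSpace ℝ {i : Fin p // r i = 2} → ℝ) (lam : ℝ)

/-- The feedback linearizes the `r_i`-th derivative of the `i`-th output. -/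
lemma H1.fderiv_lieOut_niFeedback (h1 : S.H1 r) (x : Vec n) (v : Vec p) (i : Fin p) :
    fderiv ℝ (S.lieOut (r i - 1) i) x ((S.closedLoop (S.niFeedback r V₁ V₂ lam)).rhs x v)
      = v i - S.shapingTerm r V₁ V₂ lam x i := by
  have hA : S.decoupling r x *ᵥ (S.niFeedback r V₁ V₂ lam x v).ofLp
      = v.ofLp - S.driftTerm r x - S.shapingTerm r V₁ V₂ lam x := by
    simp [niFeedback, Matrix.mulVec_mulVec, Matrix.mul_nonsing_inv _ (h1.isUnit_det x)]
  have hb : lieDeriv S.f (S.lieOut (r i - 1) i) x = S.driftTerm r x i := by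
    -- `r i - 1` is truncated subtraction; `1 ≤ r i` makes one more Lie derivative land on
    -- `L_f^{r_i} h_i`.
    obtain ⟨m, hm⟩ : ∃ m, r i = m + 1 := ⟨r i - 1, by have := (h1.2 i).1; omega⟩
    simp only [driftTerm, lieOut, hm, Nat.add_sub_cancel, Function.iterate_succ_apply']
  have hAi := congrFun hA i
  simp only [Matrix.mulVec, dotProduct, decoupling, Matrix.of_apply, Pi.sub_apply] at hAi
  rw [fderiv_closedLoop, hb]
  simp_rw [mul_comm]
  rw [hAi]
  ring

lemma H1.fderiv_lieOut_of_one (h1 : S.H1 r) (x : Vec n) (v : Vec p)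
    (i : {i : Fin p // r i = 1}) :
    fderiv ℝ (S.lieOut 0 i) x ((S.closedLoop (S.niFeedback r V₁ V₂ lam)).rhs x v)
      = v i - gradient V₁ (S.xi1 r x) i := by
  have h := h1.fderiv_lieOut_niFeedback V₁ V₂ lam x v i
  simpa [i.2, shapingTerm] using h

lemma H1.fderiv_lieOut_of_two (h1 : S.H1 r) (x : Vec n) (v : Vec p)
    (i : {i : Fin p // r i = 2}) :
    fderiv ℝ (S.lieOut 1 i) x ((S.closedLoop (S.niFeedback r V₁ V₂ lam)).rhs x v)
      = v i - (gradient V₂ (S.xi2 r x) i + lam * S.xi3 r x i) := by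
  have h := h1.fderiv_lieOut_niFeedback V₁ V₂ lam x v i
  simpa [i.2, shapingTerm] using h

/-- With relative degree 2 the input does not enter `ẏ_i`, whatever the feedback. -/
lemma H1.fderiv_lieOut_zero_of_two (h1 : S.H1 r) (x : Vec n) (v : Vec p)
    (k : Vec n → Vec p → Vec p) (i : {i : Fin p // r i = 2}) :
    fderiv ℝ (S.lieOut 0 i) x ((S.closedLoop k).rhs x v) = S.xi3 r x i := by
  rw [fderiv_closedLoop,
    Finset.sum_eq_zero fun j _ => by rw [h1.lieDeriv_lieOut_zero i.2, mul_zero]]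
  simp [xi3, lieOut]

variable {V₁ V₂ lam}

lemma IsAdmissible.contDiff_niStorage (hS : S.IsAdmissible) (hV₁ : ContDiff ℝ 1 V₁)
    (hV₂ : ContDiff ℝ 1 V₂) : ContDiff ℝ 1 (S.niStorage r V₁ V₂) := by
  have h3 : ContDiff ℝ 1 (S.xi3 r) := hS.contDiff_xi3.of_le (by simp)
  exact ((hV₁.comp (hS.contDiff_xi1.of_le (by simp))).add
    (hV₂.comp (hS.contDiff_xi2.of_le (by simp)))).add (contDiff_const.mul (h3.inner ℝ h3))

lemma IsAdmissible.isPosSemidefFun_niStorage (hS : S.IsAdmissible) (hV₁ : IsPosSemidefFun V₁)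
    (hV₂ : IsPosSemidefFun V₂) : IsPosSemidefFun (S.niStorage r V₁ V₂) := by
  refine ⟨?_, fun x => ?_⟩
  · simp [niStorage, hS.xi1_zero, hS.xi2_zero, hS.xi3_zero, hV₁.1, hV₂.1]
  · have h3 : 0 ≤ ⟪S.xi3 r x, S.xi3 r x⟫_ℝ := real_inner_self_nonneg
    have := hV₁.2 (S.xi1 r x)
    have := hV₂.2 (S.xi2 r x)
    unfold niStorage
    linarith

/-- A chain rule in coordinates. -/
lemma hasDerivWithinAt_comp_gradient {ι : Type*} [Fintype ι] {W : EuclideanSpace ℝ ι → ℝ}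
    (hW : Differentiable ℝ W) {z : ℝ → EuclideanSpace ℝ ι} {z' : ι → ℝ} {s : Set ℝ} {t : ℝ}
    (hz : ∀ i, HasDerivWithinAt (fun τ => z τ i) (z' i) s t) :
    HasDerivWithinAt (fun τ => W (z τ)) (∑ i, gradient W (z t) i * z' i) s t := by
  have hz' : HasDerivWithinAt z (WithLp.toLp 2 z') s t := hasDerivWithinAt_euclidean hz
  have h := (hW (z t)).hasGradientAt.hasFDerivAt.comp_hasDerivWithinAt t hz'
  refine h.congr_deriv ?_
  rw [InnerProductSpace.toDual_apply_apply, PiLp.inner_apply]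
  simp only [RCLike.inner_apply, conj_trivial, mul_comm]

/-- Keeping `ε` free lets one dissipation estimate serve both the NI and the OSNI claim. -/
theorem isStorage_niStorage (hS : S.IsAdmissible) (h1 : S.H1 r)
    (hV₁ : ContDiff ℝ 1 V₁) (hV₁_psd : IsPosSemidefFun V₁)
    (hV₂ : ContDiff ℝ 1 V₂) (hV₂_psd : IsPosSemidefFun V₂)
    {ε : ℝ} (hε : ε ≤ 1) (hεlam : ε ≤ lam) :
    (S.closedLoop (S.niFeedback r V₁ V₂ lam)).IsStorage ε (S.niStorage r V₁ V₂) := by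
  refine ⟨hS.contDiff_niStorage hV₁ hV₂, hS.isPosSemidefFun_niStorage hV₁_psd hV₂_psd, ?_⟩
  intro T v x hx t ht
  have hu := uniqueDiffOn_timeInterval T t ht
  have hcomp {φ : Vec n → ℝ} (hφ : ContDiff ℝ ∞ φ) :=
    ((hφ.differentiable (by simp)) (x t)).hasFDerivAt.comp_hasDerivWithinAt t (hx t ht)
  set F := (S.closedLoop (S.niFeedback r V₁ V₂ lam)).rhs (x t) (v t) with hF
  -- `w` is the value of `ẏ(t)`; everything below is expressed through `v` and `w`.
  set w : Vec p := WithLp.toLp 2 fun i => fderiv ℝ (S.lieOut 0 i) (x t) F with hw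
  have hy : HasDerivWithinAt (fun s => S.h (x s)) w (timeInterval T) t :=
    hasDerivWithinAt_euclidean fun i => hcomp (hS.contDiff_lieOut_zero i)
  -- The equation for `ẏ_i` is solved for `∂_i V₁`, so that the `V₁` part of `V̇` becomes `(v_i -
  -- w_i) w_i`.
  have hw₁ (i : {i : Fin p // r i = 1}) : gradient V₁ (S.xi1 r (x t)) i = v t i - w i := by
    have := h1.fderiv_lieOut_of_one V₁ V₂ lam (x t) (v t) i
    rw [← hF] at this
    simp only [hw, this]
    ring
  have hw₂ (i : {i : Fin p // r i = 2}) : S.xi3 r (x t) i = w i :=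
    (h1.fderiv_lieOut_zero_of_two (x t) (v t) _ i).symm
  have hd₁ := hasDerivWithinAt_comp_gradient (hV₁.differentiable (by simp))
    (z := fun s => S.xi1 r (x s)) (z' := fun i => w i)
    fun i => hcomp (hS.contDiff_lieOut_zero i)
  have hd₂ := hasDerivWithinAt_comp_gradient (hV₂.differentiable (by simp))
    (z := fun s => S.xi2 r (x s)) (z' := fun i => w i)
    fun i => hcomp (hS.contDiff_lieOut_zero i)
  have hξ₃ : HasDerivWithinAt (fun s => S.xi3 r (x s))
      (WithLp.toLp 2 fun i => v t i - (gradient V₂ (S.xi2 r (x t)) i + lam * w i))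
      (timeInterval T) t := by
    refine hasDerivWithinAt_euclidean fun i => ?_
    refine (hcomp (hS.contDiff_lieOut_one i)).congr_deriv ?_
    rw [hF, h1.fderiv_lieOut_of_two, hw₂]
  have hV := (hd₁.add hd₂).add ((hξ₃.inner ℝ hξ₃).const_mul (1 / 2 : ℝ))
  refine ⟨hy.differentiableWithinAt, ?_⟩
  change derivWithin (fun s => S.niStorage r V₁ V₂ (x s)) _ t ≤
    ⟪v t, derivWithin (fun s => S.h (x s)) _ t⟫_ℝ
      - ε * ‖derivWithin (fun s => S.h (x s)) (timeInterval T) t‖ ^ 2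
  rw [hy.derivWithin hu]
  refine (hV.derivWithin hu).trans_le ?_
  simp only [EuclideanSpace.norm_sq_eq, PiLp.inner_apply, RCLike.inner_apply, conj_trivial,
    Real.norm_eq_abs, sq_abs, hw₁, hw₂, Finset.mul_sum]
  rw [sum_eq_sum_one_add_sum_two h1.2 fun i => w i * v t i,
    sum_eq_sum_one_add_sum_two h1.2 fun i => ε * w i ^ 2]
  -- Termwise, the slack is `(1 - ε) w_i² ≥ 0`.
  have e₁ : ∑ i : {i : Fin p // r i = 1}, (v t i - w i) * w i ≤
      ∑ i : {i : Fin p // r i = 1}, w i * v t i - ∑ i : {i : Fin p // r i = 1}, ε * w i ^ 2 := by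
    rw [← Finset.sum_sub_distrib]
    refine Finset.sum_le_sum fun i _ => ?_
    nlinarith [mul_nonneg (sub_nonneg.2 hε) (sq_nonneg (w i))]
  -- The potential force `∂_i V₂` cancels against its contribution to `ξ̇₃`, leaving the slack `(λ -
  -- ε) w_i² ≥ 0`.
  have e₂ : ∑ i : {i : Fin p // r i = 2}, gradient V₂ (S.xi2 r (x t)) i * w i +
      ∑ i : {i : Fin p // r i = 2},
        (v t i - (gradient V₂ (S.xi2 r (x t)) i + lam * w i)) * w i ≤
      ∑ i : {i : Fin p // r i = 2}, w i * v t i - ∑ i : {i : Fin p // r i = 2}, ε * w i ^ 2 := by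
    rw [← Finset.sum_sub_distrib, ← Finset.sum_add_distrib]
    refine Finset.sum_le_sum fun i _ => ?_
    nlinarith [mul_nonneg (sub_nonneg.2 hεlam) (sq_nonneg (w i))]
  -- Differentiating `½⟪ξ₃, ξ₃⟫` produces the same sum with its factors in both orders; identifying
  -- them absorbs the `½`.
  have e₃ : ∑ i : {i : Fin p // r i = 2},
        w i * (v t i - (gradient V₂ (S.xi2 r (x t)) i + lam * w i)) =
      ∑ i : {i : Fin p // r i = 2},
        (v t i - (gradient V₂ (S.xi2 r (x t)) i + lam * w i)) * w i :=
    Finset.sum_congr rfl fun i _ => mul_comm _ _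
  linarith

end Feedback

end AffineSystem

end NegImag

theorem theorem2 {n p : ℕ} (S : NegImag.AffineSystem n p) (hS : S.IsAdmissible)
    (r : Fin p → ℕ) (h1 : S.H1 r) (h2 : S.H2 r) (h3 : S.H3 r)
    (V₁ : EuclideanSpace ℝ {i : Fin p // r i = 1} → ℝ)
    (hV₁ : ContDiff ℝ 1 V₁) (hV₁_psd : NegImag.IsPosSemidefFun V₁)
    (V₂ : EuclideanSpace ℝ {i : Fin p // r i = 2} → ℝ)
    (hV₂ : ContDiff ℝ 1 V₂) (hV₂_psd : NegImag.IsPosSemidefFun V₂)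
    (lam : ℝ) (hlam : 0 ≤ lam) :
    ((S.closedLoop (S.niFeedback r V₁ V₂ lam)).IsNI ∧
      (S.closedLoop (S.niFeedback r V₁ V₂ lam)).IsNIStorage (S.niStorage r V₁ V₂)) ∧
    (0 < lam →
      (S.closedLoop (S.niFeedback r V₁ V₂ lam)).IsOSNI ∧
      (S.closedLoop (S.niFeedback r V₁ V₂ lam)).IsOSNIStorage (min 1 lam)
        (S.niStorage r V₁ V₂)) := by
  have hNI := NegImag.AffineSystem.isStorage_niStorage hS h1 hV₁ hV₁_psd hV₂ hV₂_psd
    zero_le_one hlam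
  have hOSNI := NegImag.AffineSystem.isStorage_niStorage hS h1 hV₁ hV₁_psd hV₂ hV₂_psd
    (min_le_left 1 lam) (min_le_right 1 lam)
  exact ⟨⟨⟨_, hNI⟩, hNI⟩, fun h => ⟨⟨_, _, lt_min one_pos h, hOSNI⟩, lt_min one_pos h, hOSNI⟩⟩
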